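/- Corollary 5.5 (Mielnik–Plebański–Strichartz formula). Let $B$ be a (not necessarily commutative) unital real Banach algebra, for example $\mathcal M_N(\mathbb C)$, and let $\mathcal A$ be the space of locally integrable functions $\mathbb R\to B$ (Bochner, Lebesgue measure). Put $R(f)(s):=\int_0^s f(u)\,du$, $f\prec g:=f\,R(g)$, $f\succ g:=R(f)\,g$ and $f*g:=f\prec g+f\succ g$. Extend these operations coefficientwise ($\lambda$-linearly) to formal series in $\lambda\mathcal A[[\lambda]]$, adjoin a unit $\mathbf 1$ for $*$, with $f\prec\mathbf 1=f$, and set $\log^*(\mathbf 1+x):=-\sum_{m>0}\frac{(-1)^m}{m}\,x^{*m}$ for $x\in\lambda\mathcal A[[\lambda]]$. Let $a\in\mathcal A$. The linear dendriform equation $X=\mathbf 1+\lambda a\prec X$ has exactly one solution $X$ in $\mathbb R\mathbf 1\oplus\lambda\mathcal A[[\lambda]]$. Let $\Omega'(\lambda a):=\log^*(X)$, and let $\Omega(\lambda a):=R(\Omega'(\lambda a))$ be the classical Magnus element. Then for every $s>0$, as formal power series in $\lambda$, $$\Omega(\lambda a)(s)=\sum_{n>0}\lambda^n\sum_{\sigma\in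 S_n}\frac{(-1)^{d(\sigma)}}{n\binom{n-1}{d(\sigma)}}\int\cdots\int_{0<u_n<\cdots<u_1<s}a(u_{\sigma_1})\cdots a(u_{\sigma_n})\,du_1\cdots du_n ,$$ where $d(\sigma)$ is the number of descents of $\sigma$, that is, of indices $1\le i\le n-1$ with $\sigma_i>\sigma_{i+1}$, and all the integrals converge absolutely. -/

import Mathlib

open MeasureTheory

namespace Magnus

/-! ### Dendriform algebras -/

/-- A dendriform algebra over a field `k`: a vector space with two bilinear operations `≺` (`prec`)
and `≻` (`succ`) satisfying the three dendriform axioms. -/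
class Dendriform (k D : Type*) [Field k] [AddCommGroup D] [Module k D] where
  prec : D →ₗ[k] D →ₗ[k] D
  succ : D →ₗ[k] D →ₗ[k] D
  prec_prec : ∀ a b c : D, prec (prec a b) c = prec a (prec b c + succ b c)
  succ_prec : ∀ a b c : D, prec (succ a b) c = succ a (prec b c)
  succ_succ : ∀ a b c : D, succ a (succ b c) = succ (prec a b + succ a b) c

section Dendriform

variable (k : Type*) {D : Type*} [Field k] [AddCommGroup D] [Module k D] [Dendriform k D]

/-- The associative product `x * y = x ≺ y + x ≻ y`. -/
def starMul (x y : D) : D := Dendriform.prec (k := k) x y + Dendriform.succ (k := k) x y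

/-- `starPow k x m` is the `(m + 1)`-st power `x * x * ⋯ * x` (`m + 1` factors). -/
def starPow (x : D) : ℕ → D
  | 0 => x
  | m + 1 => starMul k x (starPow x m)

/-- Elements of the unital augmentation `k 𝟏 ⊕ D` are pairs `(c, x)`, standing for `c 𝟏 + x`.
This is `a ≺ (c 𝟏 + x) = c a + a ≺ x`, for `a` in `D` (recall `a ≺ 𝟏 = a`). -/
def precAug (a : D) (X : k × D) : D := X.1 • a + Dendriform.prec (k := k) a X.2

/-- `X` solves the linear dendriform equation `X = 𝟏 + a ≺ X` in `k 𝟏 ⊕ D`. -/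
def IsSolution (a : D) (X : k × D) : Prop := X = (1, precAug k a X)

end Dendriform

/-! ### Formal series with coefficients in a dendriform algebra -/

/-- `λ D[[λ]]`: the formal series `∑_{n ≥ 1} x_n λ ^ n`, as sequences with vanishing `0`-th term. -/
def FormalSeries (k D : Type*) [Field k] [AddCommGroup D] [Module k D] :
    Submodule k (ℕ → D) where
  carrier := {x | x 0 = 0}
  add_mem' := by
    intro x y hx hy
    simp only [Set.mem_ofPred_eq] at hx hy
    simp [hx, hy]
  zero_mem' := rfl
  smul_mem' := by
    intro c x hx
    simp only [Set.mem_ofPred_eq] at hx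
    simp [hx]

namespace FormalSeries

variable {k D E : Type*} [Field k] [AddCommGroup D] [Module k D] [AddCommGroup E] [Module k E]

/-- The `λ`-bilinear extension of a bilinear operation (Cauchy product). -/
def cauchy (p : D →ₗ[k] D →ₗ[k] D) :
    FormalSeries k D →ₗ[k] FormalSeries k D →ₗ[k] FormalSeries k D :=
  LinearMap.mk₂ k
    (fun x y => ⟨fun n => ∑ ij ∈ Finset.HasAntidiagonal.antidiagonal n, p (x.1 ij.1) (y.1 ij.2), by
      have hx : x.1 0 = 0 := x.2
      change ∑ ij ∈ Finset.HasAntidiagonal.antidiagonal 0, p (x.1 ij.1) (y.1 ij.2) = 0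
      simp [hx]⟩)
    (by intro x x' y; ext n; simp [Finset.sum_add_distrib])
    (by intro c x y; ext n; simp [Finset.smul_sum])
    (by intro x y y'; ext n; simp [Finset.sum_add_distrib])
    (by intro c x y; ext n; simp [Finset.smul_sum])

theorem cauchy_coeff (p : D →ₗ[k] D →ₗ[k] D) (x y : FormalSeries k D) (n : ℕ) :
    (cauchy p x y).1 n = ∑ ij ∈ Finset.HasAntidiagonal.antidiagonal n, p (x.1 ij.1) (y.1 ij.2) := rfl

theorem cauchy_assoc (p q p' q' : D →ₗ[k] D →ₗ[k] D)
    (h : ∀ a b c, p (q a b) c = p' a (q' b c)) (x y z : FormalSeries k D) :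
    cauchy p (cauchy q x y) z = cauchy p' x (cauchy q' y z) := by
  ext n
  simp only [cauchy_coeff, map_sum, LinearMap.sum_apply, Finset.sum_sigma', h]
  apply Finset.sum_nbij' (fun ⟨⟨_i, j⟩, ⟨k, l⟩⟩ ↦ ⟨(k, l + j), (l, j)⟩)
    (fun ⟨⟨i, _j⟩, ⟨k, l⟩⟩ ↦ ⟨(i + k, l), (i, k)⟩) <;>
    simp +contextual [← add_assoc]
  rintro ⟨⟨i, j⟩, ⟨k, l⟩⟩ h1 h2
  simp only at h1 h2 ⊢
  omega

theorem cauchy_add (p q : D →ₗ[k] D →ₗ[k] D) (x y : FormalSeries k D) :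
    cauchy (p + q) x y = cauchy p x y + cauchy q x y := by
  ext n
  simp [cauchy_coeff, Finset.sum_add_distrib]

instance [Dendriform k D] : Dendriform k (FormalSeries k D) where
  prec := cauchy Dendriform.prec
  succ := cauchy Dendriform.succ
  prec_prec x y z := by
    rw [← cauchy_add]
    exact cauchy_assoc _ _ _ _ (fun a b c => Dendriform.prec_prec a b c) x y z
  succ_prec x y z :=
    cauchy_assoc _ _ _ _ (fun a b c => Dendriform.succ_prec a b c) x y z
  succ_succ x y z := by
    rw [← cauchy_add]
    exact (cauchy_assoc _ _ _ _ (fun a b c => (Dendriform.succ_succ a b c).symm) x y z).symm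

variable (k) in
/-- The series `λ a`. -/
def lam (a : D) : FormalSeries k D :=
  ⟨fun n => if n = 1 then a else 0, by change (if (0 : ℕ) = 1 then a else 0) = 0; simp⟩

/-- The coefficientwise extension of a linear map. -/
def map (f : D →ₗ[k] E) (x : FormalSeries k D) : FormalSeries k E :=
  ⟨fun n => f (x.1 n), by
    have hx : x.1 0 = 0 := x.2
    change f (x.1 0) = 0
    simp [hx]⟩

/-- The power `x ^ {* (m + 1)}` has no terms of degree `≤ m`. -/
theorem starPow_coeff_eq_zero [Dendriform k D] (x : FormalSeries k D) (m n : ℕ) (h : n ≤ m) :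
    (starPow k x m).1 n = 0 := by
  have hx : x.1 0 = 0 := x.2
  induction m generalizing n with
  | zero => obtain rfl : n = 0 := by omega
            exact hx
  | succ m ih =>
    have key : ∀ p : D →ₗ[k] D →ₗ[k] D, (cauchy p x (starPow k x m)).1 n = 0 := by
      intro p
      rw [cauchy_coeff]
      refine Finset.sum_eq_zero fun ij hij => ?_
      rw [Finset.HasAntidiagonal.mem_antidiagonal] at hij
      rcases Nat.eq_zero_or_pos ij.1 with h0 | h0
      · simp [h0, hx]
      · rw [ih ij.2 (by omega), map_zero]
    change (cauchy Dendriform.prec x (starPow k x m)).1 n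
      + (cauchy Dendriform.succ x (starPow k x m)).1 n = 0
    rw [key, key, add_zero]

/-- `log^* (𝟏 + x) = - ∑_{m ≥ 1} (-1) ^ m x ^ {* m} / m` for `x ∈ λ D[[λ]]`. The coefficient of
`λ ^ n` involves the terms `m ≤ n` only, because `x ^ {* m}` starts in degree `m`. Below, `m + 1`
is written for the summation index `m` of the formula. -/
def logStar [CharZero k] [Dendriform k D] (X : k × FormalSeries k D) : FormalSeries k D :=
  ⟨fun n => -∑ m ∈ Finset.range n, ((-1 : k) ^ (m + 1) / ((m + 1 : ℕ) : k)) • (starPow k X.2 m).1 n,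
    by change -∑ m ∈ Finset.range 0, _ = (0 : D); simp⟩

end FormalSeries

/-! ### Locally integrable functions of one real variable -/

section LocInt

theorem loc_int {B : Type*} [NormedRing B] {f : ℝ → B} (hf : LocallyIntegrable f volume) (x y : ℝ) :
    IntervalIntegrable f volume x y :=
  intervalIntegrable_iff.2 ((hf.integrableOn_isCompact isCompact_uIcc).mono_set
    Set.uIoc_subset_uIcc)

variable (B : Type*) [NormedRing B] [NormedAlgebra ℝ B]

/-- The space of locally integrable functions `ℝ → B`. -/
def LocInt : Submodule ℝ (ℝ → B) where
  carrier := {f | LocallyIntegrable f volume}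
  add_mem' := fun hf hg => LocallyIntegrable.add hf hg
  zero_mem' := locallyIntegrable_zero
  smul_mem' := fun c _ hf => LocallyIntegrable.smul hf c

variable {B}

theorem LocInt.continuous_primitive (f : LocInt B) :
    Continuous fun s => ∫ u in (0 : ℝ)..s, f.1 u :=
  intervalIntegral.continuous_primitive (loc_int f.2) 0

/-- The Rota--Baxter operator `(R a)(s) = ∫_0^s a(u) du`. -/
noncomputable def R : LocInt B →ₗ[ℝ] LocInt B where
  toFun f := ⟨fun s => ∫ u in (0 : ℝ)..s, f.1 u, (LocInt.continuous_primitive f).locallyIntegrable⟩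
  map_add' f g := by
    ext s
    exact intervalIntegral.integral_add ((loc_int f.2) 0 s) ((loc_int g.2) 0 s)
  map_smul' c f := by
    ext s
    exact intervalIntegral.integral_smul c f.1

theorem R_apply (f : LocInt B) (s : ℝ) : (R f).1 s = ∫ u in (0 : ℝ)..s, f.1 u := rfl

theorem R_continuous (f : LocInt B) : Continuous (R f).1 := (LocInt.continuous_primitive f)

theorem locInt_mul_continuous (f : LocInt B) {g : ℝ → B} (hg : Continuous g) :
    (fun s => f.1 s * g s) ∈ LocInt B :=
  locallyIntegrable_iff.2 fun _ hK =>
    (LocallyIntegrable.integrableOn_isCompact f.2 hK).mul_continuousOn hg.continuousOn hK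

theorem continuous_mul_locInt (f : LocInt B) {g : ℝ → B} (hg : Continuous g) :
    (fun s => g s * f.1 s) ∈ LocInt B :=
  locallyIntegrable_iff.2 fun _ hK =>
    (LocallyIntegrable.integrableOn_isCompact f.2 hK).continuousOn_mul hg.continuousOn hK

/-- `(f ≺ g)(s) = f(s) ∫_0^s g(u) du`. -/
noncomputable def locPrec : LocInt B →ₗ[ℝ] LocInt B →ₗ[ℝ] LocInt B :=
  LinearMap.mk₂ ℝ (fun f g => ⟨fun s => f.1 s * (R g).1 s, locInt_mul_continuous f (R_continuous g)⟩)
    (by intro f f' g; ext s; simp [add_mul])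
    (by intro c f g; ext s; simp)
    (by intro f g g'; ext s; simp [mul_add])
    (by intro c f g; ext s; simp)

/-- `(f ≻ g)(s) = (∫_0^s f(u) du) g(s)`. -/
noncomputable def locSucc : LocInt B →ₗ[ℝ] LocInt B →ₗ[ℝ] LocInt B :=
  LinearMap.mk₂ ℝ (fun f g => ⟨fun s => (R f).1 s * g.1 s, continuous_mul_locInt g (R_continuous f)⟩)
    (by intro f f' g; ext s; simp [add_mul])
    (by intro c f g; ext s; simp)
    (by intro f g g'; ext s; simp [mul_add])
    (by intro c f g; ext s; simp)

/-- Integration by parts on `[0, s]` with `0 ≤ s`. -/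
theorem integral_mul_integral_of_nonneg [CompleteSpace B] {f g : ℝ → B}
    (hf : LocallyIntegrable f volume) (hg : LocallyIntegrable g volume) {s : ℝ} (hs : 0 ≤ s) :
    (∫ u in (0 : ℝ)..s, f u) * (∫ u in (0 : ℝ)..s, g u)
      = (∫ u in (0 : ℝ)..s, f u * ∫ v in (0 : ℝ)..u, g v)
        + ∫ u in (0 : ℝ)..s, (∫ v in (0 : ℝ)..u, f v) * g u := by
  have hF : Integrable f (volume.restrict (Set.Ioc 0 s)) :=
    (intervalIntegrable_iff_integrableOn_Ioc_of_le hs).1 (loc_int hf _ _)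
  have hG : Integrable g (volume.restrict (Set.Ioc 0 s)) :=
    (intervalIntegrable_iff_integrableOn_Ioc_of_le hs).1 (loc_int hg _ _)
  have hFG := hF.mul_prod hG
  have hT : MeasurableSet {z : ℝ × ℝ | z.2 ≤ z.1} := measurableSet_le measurable_snd measurable_fst
  have h0 := integral_prod_bilin (ContinuousLinearMap.mul ℝ B) hF hG
  simp only [ContinuousLinearMap.mul_apply'] at h0
  rw [intervalIntegral.integral_of_le hs, intervalIntegral.integral_of_le hs, ← h0,
    ← integral_add_compl hT hFG, ← integral_indicator hT, ← integral_indicator hT.compl,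
    integral_prod _ (hFG.indicator hT), integral_prod_symm _ (hFG.indicator hT.compl),
    intervalIntegral.integral_of_le hs, intervalIntegral.integral_of_le hs]
  congr 1
  · refine setIntegral_congr_fun measurableSet_Ioc fun u hu => ?_
    have h1 : ∀ v, Set.indicator {z : ℝ × ℝ | z.2 ≤ z.1} (fun z => f z.1 * g z.2) (u, v)
        = Set.indicator (Set.Iic u) (fun v => f u * g v) v := by
      intro v; simp [Set.indicator]
    simp only [h1]
    rw [setIntegral_indicator measurableSet_Iic, Set.Ioc_inter_Iic, min_eq_right hu.2,
      intervalIntegral.integral_of_le hu.1.le]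
    have hgu : Integrable g (volume.restrict (Set.Ioc 0 u)) :=
      (intervalIntegrable_iff_integrableOn_Ioc_of_le hu.1.le).1 (loc_int hg _ _)
    exact ContinuousLinearMap.integral_comp_comm (ContinuousLinearMap.mul ℝ B (f u)) hgu
  · refine setIntegral_congr_fun measurableSet_Ioc fun v hv => ?_
    have h1 : ∀ u, Set.indicator {z : ℝ × ℝ | z.2 ≤ z.1}ᶜ (fun z => f z.1 * g z.2) (u, v)
        = Set.indicator (Set.Iio v) (fun u => f u * g v) u := by
      intro v; simp [Set.indicator]
    simp only [h1]
    rw [setIntegral_indicator measurableSet_Iio, intervalIntegral.integral_of_le hv.1.le]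
    have h2 : Set.Ioc 0 s ∩ Set.Iio v = Set.Ioo 0 v := by
      ext u; simp only [Set.mem_inter_iff, Set.mem_Ioc, Set.mem_Iio, Set.mem_Ioo]
      have := hv.2
      constructor
      · rintro ⟨⟨h, -⟩, h'⟩; exact ⟨h, h'⟩
      · rintro ⟨h, h'⟩; exact ⟨⟨h, by linarith⟩, h'⟩
    have hfv : Integrable f (volume.restrict (Set.Ioc 0 v)) :=
      (intervalIntegrable_iff_integrableOn_Ioc_of_le hv.1.le).1 (loc_int hf _ _)
    rw [h2, ← integral_Ioc_eq_integral_Ioo]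
    exact ContinuousLinearMap.integral_comp_comm ((ContinuousLinearMap.mul ℝ B).flip (g v)) hfv

/-- The Rota--Baxter relation of weight zero: `R(f) R(g) = R(f ≺ g + f ≻ g)`. -/
theorem R_mul_R [CompleteSpace B] (f g : LocInt B) (s : ℝ) :
    (R f).1 s * (R g).1 s = (R (locPrec f g + locSucc f g)).1 s := by
  rw [map_add]
  change (∫ u in (0 : ℝ)..s, f.1 u) * (∫ u in (0 : ℝ)..s, g.1 u)
      = (∫ u in (0 : ℝ)..s, f.1 u * ∫ v in (0 : ℝ)..u, g.1 v)
        + ∫ u in (0 : ℝ)..s, (∫ v in (0 : ℝ)..u, f.1 v) * g.1 u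
  rcases le_total 0 s with hs | hs
  · exact integral_mul_integral_of_nonneg f.2 g.2 hs
  · have hneg : ∀ h : LocInt B, LocallyIntegrable (fun x => h.1 (-x)) volume := fun h =>
      locallyIntegrable_iff.2 fun K hK => by
        have h1 := LocallyIntegrable.integrableOn_isCompact h.2 hK.neg
        have h2 := (Measure.measurePreserving_neg (volume : Measure ℝ)).integrableOn_comp_preimage
          (Homeomorph.neg ℝ).measurableEmbedding (f := h.1) (s := -K)
        have h3 := h2.2 h1
        simpa [Function.comp_def] using h3
    have hint : ∀ (h : ℝ → B) (t : ℝ), ∫ u in (0 : ℝ)..t, h (-u) = -∫ u in (0 : ℝ)..(-t), h u := by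
      intro h t
      rw [intervalIntegral.integral_comp_neg, neg_zero, intervalIntegral.integral_symm]
    have key := integral_mul_integral_of_nonneg (hneg f) (hneg g) (s := -s) (by linarith)
    simp only [hint, neg_neg, neg_mul, mul_neg, intervalIntegral.integral_neg] at key
    rw [hint (fun u => f.1 u * ∫ v in (0 : ℝ)..u, g.1 v),
      hint (fun u => (∫ v in (0 : ℝ)..u, f.1 v) * g.1 u)] at key
    simpa using key

/-- The dendriform algebra of locally integrable functions. -/
noncomputable instance [CompleteSpace B] : Dendriform ℝ (LocInt B) where
  prec := locPrec
  succ := locSucc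
  prec_prec f g h := by
    ext s
    change f.1 s * (R g).1 s * (R h).1 s = f.1 s * (R (locPrec g h + locSucc g h)).1 s
    rw [mul_assoc, R_mul_R]
  succ_prec f g h := by
    ext s
    change (R f).1 s * g.1 s * (R h).1 s = (R f).1 s * (g.1 s * (R h).1 s)
    rw [mul_assoc]
  succ_succ f g h := by
    ext s
    change (R f).1 s * ((R g).1 s * h.1 s) = (R (locPrec f g + locSucc f g)).1 s * h.1 s
    rw [← mul_assoc, R_mul_R]

end LocInt

/-! ### Permutations and simplices -/

/-- The number of descents of `σ ∈ S_n`: positions `i` such that `σ (i) > σ (i + 1)`. -/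
def descents {n : ℕ} (σ : Equiv.Perm (Fin n)) : ℕ :=
  (Finset.univ.filter fun i : Fin n =>
    ∃ h : (i : ℕ) + 1 < n, σ ⟨(i : ℕ) + 1, h⟩ < σ i).card

/-- The simplex `0 < u_n < ⋯ < u_1 < s`. -/
def simplex (n : ℕ) (s : ℝ) : Set (Fin n → ℝ) :=
  {u | (∀ i, 0 < u i ∧ u i < s) ∧ ∀ i j, i < j → u j < u i}

/-- The ordered product `a(u_{σ_1}) a(u_{σ_2}) ⋯ a(u_{σ_n})`. -/
def orderedProd {B : Type*} [Monoid B] (a : ℝ → B) {n : ℕ} (σ : Equiv.Perm (Fin n))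
    (u : Fin n → ℝ) : B :=
  (List.ofFn fun i => a (u (σ i))).prod

end Magnus

/-!
The primitive at `s` turns the product `*` into the product of `B`, so it sends `log^* X` to
`log (1 + Y) = ∫_0^1 Y (1 + y Y)⁻¹ dy`, where `U(t) = 1 + λ ∫_0^t a + ⋯` is the Dyson series of `a`
and `Y = U(s) - 1`. Put `x = -y`. The series `V(t) = U(t) (1 - x Y)⁻¹` satisfies
`V(t) = 1 + λ ∫_0^t a V + x λ ∫_0^s a V`, so the coefficients of `Y (1 - x Y)⁻¹` are integrals over
cubes `(0, s) ^ n` of `a(u_1) ⋯ a(u_n)` with weight `∏ (x + [u_{i+1} < u_i])`. Cutting the cube into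
`n!` chambers according to the order of the `u_i`, the weight on the chamber of `σ` is
`x ^ d (1 + x) ^ (n - 1 - d)` with `d = d(σ)`, and its integral over `y` is a Beta integral.
-/

namespace Magnus

open PowerSeries

section GeometricSeries

variable {k A : Type*} [CommSemiring k] [Semiring A] [Algebra k A]

/-- The geometric series `∑_{m ≥ 0} x ^ m Y ^ (m + 1) = Y (1 - x Y)⁻¹` of a power series `Y` without
constant term. The sum is cut off at `m < n` in degree `n`, because `Y ^ (m + 1)` starts in degree
`m + 1`. -/
noncomputable def geomSeries (x : k) (Y : A⟦X⟧) : A⟦X⟧ :=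
  .mk fun n => ∑ m ∈ Finset.range n, x ^ m • coeff n (Y ^ (m + 1))

theorem coeff_geomSeries (x : k) (Y : A⟦X⟧) (n : ℕ) :
    coeff n (geomSeries x Y) = ∑ m ∈ Finset.range n, x ^ m • coeff n (Y ^ (m + 1)) :=
  coeff_mk _ _

theorem coeff_geomSeries_of_le {Y : A⟦X⟧} (hY : constantCoeff Y = 0) (x : k) {n N : ℕ}
    (h : n ≤ N) :
    coeff n (geomSeries x Y) = coeff n (∑ m ∈ Finset.range N, x ^ m • Y ^ (m + 1)) := by
  simp only [coeff_geomSeries, map_sum, coeff_smul]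
  refine Finset.sum_subset (Finset.range_mono h) fun m _ hm => ?_
  have hnm : n < m + 1 := by simpa [Nat.lt_succ_iff] using hm
  rw [coeff_of_lt_order n ((Nat.cast_lt.2 hnm).trans_le
    (le_order_pow_of_constantCoeff_eq_zero _ hY)), smul_zero]

theorem geomSeries_eq_mul {Y : A⟦X⟧} (hY : constantCoeff Y = 0) (x : k) :
    geomSeries x Y = Y * (1 + x • geomSeries x Y) := by
  ext n
  have partialSum : ∑ m ∈ Finset.range (n + 1), x ^ m • Y ^ (m + 1) =
      Y * (1 + x • ∑ m ∈ Finset.range n, x ^ m • Y ^ (m + 1)) := by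
    rw [Finset.sum_range_succ', mul_add, Finset.smul_sum, Finset.mul_sum, add_comm]
    simp [smul_smul, pow_succ']
  rw [coeff_geomSeries_of_le hY x n.le_succ, partialSum, coeff_mul, coeff_mul]
  refine Finset.sum_congr rfl fun ij hij => ?_
  simp only [map_add, coeff_smul,
    coeff_geomSeries_of_le hY x (Finset.HasAntidiagonal.antidiagonal.snd_le hij)]

end GeometricSeries

section BetaIntegral

open scoped Nat in
theorem integral_pow_mul_one_sub_pow (d e : ℕ) :
    ∫ x in (0 : ℝ)..1, x ^ d * (1 - x) ^ e = 1 / ((d + e + 1 : ℕ) * (d + e).choose d) := by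
  have beta_eq : ((∫ x in (0 : ℝ)..1, x ^ d * (1 - x) ^ e : ℝ) : ℂ) =
      Complex.betaIntegral (d + 1) (e + 1) := by
    simp [Complex.betaIntegral, ← intervalIntegral.integral_ofReal]
  have re_pos (n : ℕ) : 0 < (n + 1 : ℂ).re := by
    rw [Complex.add_re, Complex.natCast_re, Complex.one_re]
    positivity
  have gamma_eq : (d ! * e ! : ℝ) =
      (d + e + 1)! * ∫ x in (0 : ℝ)..1, x ^ d * (1 - x) ^ e := by
    have h := Complex.Gamma_mul_Gamma_eq_betaIntegral (re_pos d) (re_pos e)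
    rw [← beta_eq, Complex.Gamma_nat_eq_factorial, Complex.Gamma_nat_eq_factorial,
      show (d + 1 + (e + 1) : ℂ) = (d + e + 1 : ℕ) + 1 by push_cast; ring,
      Complex.Gamma_nat_eq_factorial] at h
    exact_mod_cast h
  have choose_eq : ((d + e).choose d * d ! * e ! : ℝ) = (d + e)! := by
    rw [Nat.choose_symm_add]
    exact_mod_cast Nat.add_choose_mul_factorial_mul_factorial d e
  rw [eq_div_iff (by have := Nat.choose_pos (Nat.le_add_right d e); positivity)]
  refine mul_left_cancel₀ (by positivity : (d ! * e ! : ℝ) ≠ 0) ?_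
  rw [Nat.factorial_succ, Nat.cast_mul, ← choose_eq] at gamma_eq
  linear_combination - gamma_eq

end BetaIntegral

section PathIntegrals

variable {α B : Type*}

/-- The product `a(u_0) a(u_1) ⋯ a(u_{n-1})` along a path `u`. -/
def pathProd [Monoid B] (a : α → B) {n : ℕ} (u : Fin n → α) : B :=
  (List.ofFn fun i => a (u i)).prod

theorem pathProd_zero [Monoid B] (a : α → B) (u : Fin 0 → α) : pathProd a u = 1 := by
  simp [pathProd]

theorem pathProd_cons [Monoid B] (a : α → B) {n : ℕ} (v : α) (u : Fin n → α) :
    pathProd a (Fin.cons v u : Fin (n + 1) → α) = a v * pathProd a u := by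
  simp [pathProd, List.ofFn_succ]

/-- The product `w(u_0, u_1) w(u_1, u_2) ⋯ w(u_{n-1}, u_n)` of the weights of the steps of a
path `u`. -/
def pathWeight (w : α → α → ℝ) {n : ℕ} (u : Fin (n + 1) → α) : ℝ :=
  ∏ i : Fin n, w (u i.castSucc) (u i.succ)

theorem pathWeight_zero (w : α → α → ℝ) (u : Fin 1 → α) : pathWeight w u = 1 := by
  simp [pathWeight]

theorem pathWeight_cons (w : α → α → ℝ) (t : α) {n : ℕ} (u : Fin (n + 1) → α) :
    pathWeight w (Fin.cons t u : Fin (n + 2) → α) = w t (u 0) * pathWeight w u := by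
  simp only [pathWeight, Fin.prod_univ_succ (n := n), ← Fin.succ_castSucc, Fin.cons_succ,
    Fin.castSucc_zero, Fin.cons_zero]

theorem norm_pathWeight_le {w : α → α → ℝ} {C : ℝ} (hC : ∀ t v, ‖w t v‖ ≤ C) {n : ℕ}
    (u : Fin (n + 1) → α) : ‖pathWeight w u‖ ≤ C ^ n := by
  rw [pathWeight, norm_prod]
  exact (Finset.prod_le_prod (fun _ _ => norm_nonneg _) fun i _ => hC _ _).trans_eq (by simp)

variable [MeasurableSpace α]

theorem measurable_pathWeight {w : α → α → ℝ} (hw : Measurable w.uncurry) (n : ℕ) :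
    Measurable fun u : Fin (n + 1) → α => pathWeight w u :=
  Finset.measurable_prod _ fun i _ =>
    hw.comp (f := fun u : Fin (n + 1) → α => (u i.castSucc, u i.succ)) (by fun_prop)

theorem measurable_finCons (n : ℕ) :
    Measurable fun p : α × (Fin n → α) => (Fin.cons p.1 p.2 : Fin (n + 1) → α) :=
  measurable_pi_iff.2 <| Fin.cases measurable_fst fun i =>
    (measurable_pi_apply i).comp measurable_snd

/-- The value at `t` of the kernel operator `f ↦ ∫ w(·, v) a(v) f(v) dμ(v)`, iterated `n` times
on the constant function `1`, as an integral over the paths of `n` steps that start at `t`. -/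
noncomputable def pathIntegral [NormedRing B] [NormedSpace ℝ B] (μ : Measure α)
    (w : α → α → ℝ) (a : α → B) (n : ℕ) (t : α) : B :=
  ∫ u : Fin n → α, pathWeight w (Fin.cons t u : Fin (n + 1) → α) • pathProd a u
    ∂(Measure.pi fun _ => μ)

theorem pathIntegral_zero [NormedRing B] [NormedSpace ℝ B] [CompleteSpace B] (μ : Measure α)
    (w : α → α → ℝ) (a : α → B) (t : α) : pathIntegral μ w a 0 t = 1 := by
  simp only [pathIntegral, pathWeight_zero, pathProd_zero, one_smul]
  rw [Measure.pi_of_empty, integral_dirac]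

section Integrals

variable {μ : Measure α} [SigmaFinite μ] [NormedRing B]

variable (μ) in
theorem measurePreserving_finCons (n : ℕ) :
    MeasurePreserving (MeasurableEquiv.piFinSuccAbove (fun _ : Fin (n + 1) => α) 0).symm
      (μ.prod (Measure.pi fun _ => μ)) (Measure.pi fun _ => μ) :=
  (measurePreserving_piFinSuccAbove (fun _ => μ) 0).symm

theorem integrable_pi_succ_iff {E : Type*} [NormedAddCommGroup E] {n : ℕ}
    {f : (Fin (n + 1) → α) → E} :
    Integrable f (Measure.pi fun _ => μ) ↔
      Integrable (fun p : α × (Fin n → α) => f (Fin.cons p.1 p.2))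
        (μ.prod (Measure.pi fun _ => μ)) := by
  rw [← (measurePreserving_finCons μ n).integrable_comp_emb (MeasurableEquiv.measurableEmbedding _)]
  simp [Function.comp_def, Fin.insertNthEquiv]

theorem integral_pi_succ {E : Type*} [NormedAddCommGroup E] [NormedSpace ℝ E] {n : ℕ}
    {f : (Fin (n + 1) → α) → E} (hf : Integrable f (Measure.pi fun _ => μ)) :
    ∫ u, f u ∂(Measure.pi fun _ => μ) =
      ∫ v, ∫ u : Fin n → α, f (Fin.cons v u) ∂(Measure.pi fun _ => μ) ∂μ := by
  rw [← integral_prod _ (integrable_pi_succ_iff.1 hf),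
    ← (measurePreserving_finCons μ n).integral_comp' f]
  simp [Fin.insertNthEquiv]

theorem integrable_pathProd {a : α → B} (ha : Integrable a μ) (n : ℕ) :
    Integrable (fun u : Fin n → α => pathProd a u) (Measure.pi fun _ => μ) := by
  induction n with
  | zero =>
    simp only [pathProd_zero]
    rw [Measure.pi_of_empty]
    exact integrable_const 1
  | succ n ih =>
    rw [integrable_pi_succ_iff]
    simpa only [pathProd_cons] using ha.mul_prod ih

variable [NormedAlgebra ℝ B] {w : α → α → ℝ} {a : α → B} {C : ℝ}

theorem integrable_pathWeight_cons_smul_pathProd (hw : Measurable w.uncurry)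
    (hC : ∀ t v, ‖w t v‖ ≤ C) (ha : Integrable a μ) (n : ℕ) (t : α) :
    Integrable (fun u : Fin n → α =>
      pathWeight w (Fin.cons t u : Fin (n + 1) → α) • pathProd a u) (Measure.pi fun _ => μ) :=
  (integrable_pathProd ha n).bdd_smul _
    ((measurable_pathWeight hw n).comp
      ((measurable_finCons n).comp measurable_prodMk_left)).aestronglyMeasurable
    (.of_forall fun _ => norm_pathWeight_le hC _)

theorem integral_mul_pathWeight_smul_pathProd (hw : Measurable w.uncurry)
    (hC : ∀ t v, ‖w t v‖ ≤ C) (ha : Integrable a μ) {φ : α → ℝ} (hφ : Measurable φ) {K : ℝ}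
    (hK : ∀ v, ‖φ v‖ ≤ K) (n : ℕ) :
    ∫ u : Fin (n + 1) → α, (φ (u 0) * pathWeight w u) • pathProd a u ∂(Measure.pi fun _ => μ) =
      ∫ v, φ v • (a v * pathIntegral μ w a n v) ∂μ := by
  have integrable : Integrable (fun u : Fin (n + 1) → α =>
      (φ (u 0) * pathWeight w u) • pathProd a u) (Measure.pi fun _ => μ) :=
    (integrable_pathProd ha (n + 1)).bdd_smul (K * C ^ n)
      ((hφ.comp (measurable_pi_apply 0)).mul (measurable_pathWeight hw n)).aestronglyMeasurable
      (.of_forall fun u => norm_mul_le_of_le (hK _) (norm_pathWeight_le hC u))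
  rw [integral_pi_succ integrable]
  congr! 2 with v
  simp only [Fin.cons_zero, pathProd_cons, mul_smul, integral_smul]
  simp only [← mul_smul_comm]
  rw [integral_const_mul_of_integrable (integrable_pathWeight_cons_smul_pathProd hw hC ha n v),
    mul_smul_comm, pathIntegral]

theorem integral_pathWeight_smul_pathProd (hw : Measurable w.uncurry) (hC : ∀ t v, ‖w t v‖ ≤ C)
    (ha : Integrable a μ) (n : ℕ) :
    ∫ u : Fin (n + 1) → α, pathWeight w u • pathProd a u ∂(Measure.pi fun _ => μ) =
      ∫ v, a v * pathIntegral μ w a n v ∂μ := by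
  simpa using integral_mul_pathWeight_smul_pathProd hw hC ha (φ := fun _ => 1) measurable_const
    (K := 1) (by simp) n

theorem pathIntegral_succ (hw : Measurable w.uncurry) (hC : ∀ t v, ‖w t v‖ ≤ C)
    (ha : Integrable a μ) (n : ℕ) (t : α) :
    pathIntegral μ w a (n + 1) t = ∫ v, w t v • (a v * pathIntegral μ w a n v) ∂μ := by
  simp only [pathIntegral, pathWeight_cons]
  exact integral_mul_pathWeight_smul_pathProd hw hC ha (hw.comp measurable_prodMk_left) (hC t) n

end Integrals

end PathIntegrals

section Chambers

section Permutations

variable {α : Type*} [LinearOrder α]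

theorem exists_strictAnti_comp_perm {n : ℕ} {u : Fin n → α} (hu : Function.Injective u) :
    ∃ σ : Equiv.Perm (Fin n), StrictAnti (u ∘ σ) :=
  ⟨Tuple.sort (OrderDual.toDual ∘ u),
    (Tuple.monotone_sort (OrderDual.toDual ∘ u)).strictMono_of_injective
      (hu.comp (Equiv.injective _))⟩

theorem perm_eq_of_strictAnti_comp {n : ℕ} {u : Fin n → α} {σ τ : Equiv.Perm (Fin n)}
    (hσ : StrictAnti (u ∘ σ)) (hτ : StrictAnti (u ∘ τ)) : σ = τ := by
  have injective : Function.Injective u := by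
    simpa [Function.comp_assoc] using hσ.injective.comp σ.symm.injective
  exact Equiv.ext <| congrFun <| injective.comp_left <|
    Tuple.unique_antitone hσ.antitone hτ.antitone

end Permutations

variable {α : Type*} [MeasurableSpace α]

variable (α) in
theorem coe_piCongrLeft_symm {ι : Type*} (σ : Equiv.Perm ι) :
    ⇑(MeasurableEquiv.piCongrLeft (fun _ : ι => α) σ.symm) = fun u => u ∘ σ := by
  ext u i
  simpa using MeasurableEquiv.piCongrLeft_apply_apply (β := fun _ => α) σ.symm u (σ i)

theorem measurableEmbedding_comp_perm {ι : Type*} (σ : Equiv.Perm ι) :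
    MeasurableEmbedding fun u : ι → α => u ∘ σ :=
  coe_piCongrLeft_symm α σ ▸ MeasurableEquiv.measurableEmbedding _

theorem measurePreserving_comp_perm {ι : Type*} [Fintype ι] (μ : Measure α) [SigmaFinite μ]
    (σ : Equiv.Perm ι) :
    MeasurePreserving (fun u : ι → α => u ∘ σ) (Measure.pi fun _ => μ) (Measure.pi fun _ => μ) :=
  coe_piCongrLeft_symm α σ ▸ measurePreserving_piCongrLeft (fun _ => μ) σ.symm

theorem ae_injective [MeasurableEq α] (μ : Measure α) [SigmaFinite μ] [NullSingletonClass μ]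
    (n : ℕ) : ∀ᵐ u : Fin n → α ∂(Measure.pi fun _ => μ), Function.Injective u := by
  have ae_ne : ∀ {i j : Fin n}, i ≠ j → ∀ᵐ u : Fin n → α ∂(Measure.pi fun _ => μ), u i ≠ u j := by
    rintro i j hij
    obtain ⟨n, rfl⟩ : ∃ m, n = m + 1 := ⟨n - 1, by have := i.pos; omega⟩
    obtain ⟨j, rfl⟩ := Fin.exists_succAbove_eq hij.symm
    have ae_prod : ∀ᵐ p ∂(μ.prod (Measure.pi fun _ : Fin n => μ)), p.1 ≠ p.2 j := by
      refine (Measure.ae_prod_iff_ae_ae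
        (measurableSet_eq_fun measurable_fst (by fun_prop)).compl).2 (.of_forall fun v => ?_)
      filter_upwards [Measure.ae_eval_ne (μ := fun _ : Fin n => μ) j v] with u hu using hu.symm
    exact (measurePreserving_piFinSuccAbove (fun _ => μ) i).quasiMeasurePreserving.ae ae_prod
  filter_upwards [ae_all_iff.2 fun p : {p : Fin n × Fin n // p.1 ≠ p.2} => ae_ne p.2] with u hu i j
  contrapose!
  exact fun hij => hu ⟨(i, j), hij⟩

variable [LinearOrder α] [TopologicalSpace α] [OrderClosedTopology α]
  [SecondCountableTopology α] [OpensMeasurableSpace α]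

theorem measurableSet_strictAnti (n : ℕ) : MeasurableSet {u : Fin n → α | StrictAnti u} := by
  simp only [StrictAnti, Set.ofPred_forall]
  exact .iInter fun i => .iInter fun j => .iInter fun _ =>
    measurableSet_lt (measurable_pi_apply j) (measurable_pi_apply i)

theorem integral_pi_eq_sum_perm {μ : Measure α} [SigmaFinite μ] [NullSingletonClass μ] {E : Type*}
    [NormedAddCommGroup E] [NormedSpace ℝ E] {n : ℕ} {f : (Fin n → α) → E}
    (hf : Integrable f (Measure.pi fun _ => μ)) :
    ∫ u, f u ∂(Measure.pi fun _ => μ) = ∑ σ : Equiv.Perm (Fin n),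
      ∫ u in {u | StrictAnti u}, f (u ∘ σ) ∂(Measure.pi fun _ => μ) := by
  let chamber (σ : Equiv.Perm (Fin n)) : Set (Fin n → α) := {u | StrictAnti (u ∘ σ)}
  have measurable_chamber (σ) : MeasurableSet (chamber σ) :=
    (measurableEmbedding_comp_perm σ).measurable (measurableSet_strictAnti n)
  have disjoint : Pairwise (Function.onFun Disjoint chamber) := fun σ τ hστ =>
    Set.disjoint_left.2 fun u hσ hτ => hστ (perm_eq_of_strictAnti_comp hσ hτ)
  have cover : ⋃ σ, chamber σ =ᵐ[Measure.pi fun _ => μ] Set.univ := by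
    filter_upwards [ae_injective μ n] with u hu
    exact eq_true (Set.mem_iUnion.2 (exists_strictAnti_comp_perm hu))
  rw [← setIntegral_univ, ← setIntegral_congr_set cover,
    integral_iUnion_fintype measurable_chamber disjoint fun _ => hf.integrableOn,
    ← Equiv.sum_comp (Equiv.inv (Equiv.Perm (Fin n)))]
  refine Finset.sum_congr rfl fun σ _ => ?_
  rw [← (measurePreserving_comp_perm μ σ⁻¹).setIntegral_preimage_emb
    (measurableEmbedding_comp_perm σ⁻¹) (fun u => f (u ∘ σ))]
  simp [chamber, Function.comp_assoc]

end Chambers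

section Descents

variable {α : Type*} [LinearOrder α]

/-- The weight of a step from `t` to `v`: a downward step contributes `1 + x` and any other step
contributes `x`. -/
def stepWeight (x : ℝ) (t v : α) : ℝ := if v < t then 1 + x else x

theorem norm_stepWeight_le (x : ℝ) (t v : α) : ‖stepWeight x t v‖ ≤ 1 + |x| := by
  rw [stepWeight]
  split_ifs
  · simpa using abs_add_le 1 x
  · simp

theorem measurable_stepWeight [TopologicalSpace α] [OrderClosedTopology α]
    [SecondCountableTopology α] [MeasurableSpace α] [OpensMeasurableSpace α] (x : ℝ) :
    Measurable (stepWeight x : α → α → ℝ).uncurry :=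
  .ite (measurableSet_lt measurable_snd measurable_fst) measurable_const measurable_const

theorem descents_succ_eq_card {n : ℕ} (σ : Equiv.Perm (Fin (n + 1))) :
    descents σ = ({i | σ i.succ < σ i.castSucc} : Finset (Fin n)).card := by
  rw [descents, Fin.univ_castSuccEmb, Finset.filter_cons_of_neg _ _ _ _ (by simp),
    Finset.filter_map, Finset.card_map]
  congr! 2
  exact exists_prop_of_true (by simp)

theorem descents_le {n : ℕ} (σ : Equiv.Perm (Fin (n + 1))) : descents σ ≤ n := by
  rw [descents_succ_eq_card]
  exact (Finset.card_le_univ _).trans_eq (Fintype.card_fin n)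

theorem pathWeight_stepWeight_comp_perm (x : ℝ) {n : ℕ} {u : Fin (n + 1) → α} (hu : StrictAnti u)
    (σ : Equiv.Perm (Fin (n + 1))) :
    pathWeight (stepWeight x) (u ∘ σ) = x ^ descents σ * (1 + x) ^ (n - descents σ) := by
  have step_iff (i : Fin n) : u (σ i.succ) < u (σ i.castSucc) ↔ ¬ σ i.succ < σ i.castSucc := by
    rw [hu.lt_iff_gt, not_lt, le_iff_lt_or_eq, or_iff_left]
    exact fun h => (Fin.castSucc_lt_succ (i := i)).ne (σ.injective h)
  have card_not : ({i | ¬ σ i.succ < σ i.castSucc} : Finset (Fin n)).card =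
      n - descents σ := by
    rw [descents_succ_eq_card, ← Finset.compl_filter, Finset.card_compl, Fintype.card_fin]
  simp only [pathWeight, stepWeight, Function.comp_apply, step_iff, ite_not]
  rw [Finset.prod_ite, Finset.prod_const, Finset.prod_const, card_not, descents_succ_eq_card]

theorem integral_pathWeight_stepWeight_eq_sum_perm {B : Type*} [NormedRing B] [NormedAlgebra ℝ B]
    [TopologicalSpace α] [OrderClosedTopology α] [SecondCountableTopology α] [MeasurableSpace α]
    [OpensMeasurableSpace α] {μ : Measure α} [SigmaFinite μ] [NullSingletonClass μ] {a : α → B}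
    (ha : Integrable a μ) (x : ℝ) (n : ℕ) :
    ∫ u : Fin (n + 1) → α, pathWeight (stepWeight x) u • pathProd a u ∂(Measure.pi fun _ => μ) =
      ∑ σ : Equiv.Perm (Fin (n + 1)), (x ^ descents σ * (1 + x) ^ (n - descents σ)) •
        ∫ u in {u | StrictAnti u}, pathProd a (u ∘ σ) ∂(Measure.pi fun _ => μ) := by
  have integrable : Integrable (fun u : Fin (n + 1) → α =>
      pathWeight (stepWeight x) u • pathProd a u) (Measure.pi fun _ => μ) :=
    (integrable_pathProd ha (n + 1)).bdd_smul _
      (measurable_pathWeight (measurable_stepWeight x) n).aestronglyMeasurable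
      (.of_forall fun u => norm_pathWeight_le (norm_stepWeight_le x) u)
  rw [integral_pi_eq_sum_perm integrable]
  refine Finset.sum_congr rfl fun σ _ => ?_
  rw [← integral_smul]
  refine setIntegral_congr_fun (measurableSet_strictAnti _) fun u hu => ?_
  simp only [pathWeight_stepWeight_comp_perm x hu]

end Descents

section Simplex

theorem simplex_eq_inter (n : ℕ) (s : ℝ) :
    simplex n s = {u | StrictAnti u} ∩ Set.univ.pi fun _ => Set.Ioo 0 s := by
  ext u
  rw [Set.inter_comm, Set.mem_inter_iff, Set.mem_univ_pi]
  exact Iff.rfl.and ⟨fun h _ _ hij => h _ _ hij, fun h _ _ hij => h hij⟩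

theorem restrict_simplex (n : ℕ) (s : ℝ) :
    volume.restrict (simplex n s) =
      (Measure.pi fun _ => volume.restrict (Set.Ioo 0 s)).restrict {u | StrictAnti u} := by
  rw [simplex_eq_inter, ← Measure.restrict_restrict (measurableSet_strictAnti n), volume_pi,
    Measure.restrict_pi_pi]

theorem integrableOn_Ioo {E : Type*} [NormedAddCommGroup E] {f : ℝ → E}
    (hf : LocallyIntegrable f volume) (s t : ℝ) : IntegrableOn f (Set.Ioo s t) volume :=
  (hf.integrableOn_isCompact isCompact_Icc).mono_set Set.Ioo_subset_Icc_self

theorem integrableOn_orderedProd {B : Type*} [NormedRing B] {a : ℝ → B}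
    (ha : LocallyIntegrable a volume) {n : ℕ} (s : ℝ) (σ : Equiv.Perm (Fin n)) :
    IntegrableOn (orderedProd a σ) (simplex n s) volume := by
  rw [IntegrableOn, restrict_simplex]
  exact (((measurePreserving_comp_perm _ σ).integrable_comp_emb
    (measurableEmbedding_comp_perm σ)).2 (integrable_pathProd (integrableOn_Ioo ha 0 s) n)).restrict

end Simplex

section Solution

variable {k D : Type*} [Field k] [AddCommGroup D] [Module k D]

theorem cauchy_lam_succ (p : D →ₗ[k] D →ₗ[k] D) (a : D) (x : FormalSeries k D) (n : ℕ) :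
    (FormalSeries.cauchy p (FormalSeries.lam k a) x).1 (n + 1) = p a (x.1 n) := by
  rw [FormalSeries.cauchy_coeff, Finset.Nat.sum_antidiagonal_succ, Finset.sum_eq_single (0, n)]
  · simp [FormalSeries.lam]
  · rintro ⟨i, j⟩ hij hne
    have : i ≠ 0 := by
      rintro rfl
      simp_all
    simp [FormalSeries.lam, this]
  · simp

variable [Dendriform k D]

variable (k) in
/-- The series `∑_{n ≥ 1} (a ≺ (a ≺ (⋯ ≺ (a ≺ a)))) λ ^ n`, with `n` factors `a` in degree `n`:
the part without constant term of the solution of `X = 𝟏 + λ a ≺ X`. -/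
def precSeries (a : D) : FormalSeries k D :=
  ⟨fun
    | 0 => 0
    | n + 1 => (Dendriform.prec (k := k) a)^[n] a, rfl⟩

theorem precSeries_one (a : D) : (precSeries k a).1 1 = a := rfl

theorem precSeries_add_two (a : D) (n : ℕ) :
    (precSeries k a).1 (n + 2) = Dendriform.prec (k := k) a ((precSeries k a).1 (n + 1)) :=
  Function.iterate_succ_apply' _ _ _

theorem precAug_lam_coeff_succ (a : D) (x : FormalSeries k D) (n : ℕ) :
    (precAug k (FormalSeries.lam k a) (1, x)).1 (n + 1) =
      (FormalSeries.lam k a).1 (n + 1) + Dendriform.prec (k := k) a (x.1 n) := by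
  rw [← cauchy_lam_succ, precAug, one_smul]
  rfl

theorem eq_precAug_lam_iff (a : D) (x : FormalSeries k D) :
    x = precAug k (FormalSeries.lam k a) (1, x) ↔
      x.1 1 = a ∧ ∀ n, x.1 (n + 2) = Dendriform.prec (k := k) a (x.1 (n + 1)) := by
  have coeff_zero : x.1 0 = 0 := x.2
  have coeff_iff : x = precAug k (FormalSeries.lam k a) (1, x) ↔
      ∀ n, x.1 (n + 1) = (precAug k (FormalSeries.lam k a) (1, x)).1 (n + 1) := by
    refine ⟨fun h n => congrFun (congrArg Subtype.val h) _, fun h => Subtype.ext (funext ?_)⟩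
    rintro (_ | n)
    exacts [coeff_zero.trans (precAug k (FormalSeries.lam k a) (1, x)).2.symm, h n]
  rw [coeff_iff, ← Nat.and_forall_add_one]
  simp only [precAug_lam_coeff_succ]
  simp [FormalSeries.lam, coeff_zero]

theorem isSolution_lam_iff (a : D) (X : k × FormalSeries k D) :
    IsSolution k (FormalSeries.lam k a) X ↔ X = (1, precSeries k a) := by
  constructor
  · intro h
    obtain ⟨c, x⟩ := X
    obtain rfl : c = 1 := congrArg Prod.fst h
    obtain ⟨one, add_two⟩ := (eq_precAug_lam_iff a x).1 (congrArg Prod.snd h)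
    refine Prod.ext rfl (Subtype.ext (funext fun n => ?_))
    induction n with
    | zero => exact x.2
    | succ n ih =>
      cases n with
      | zero => exact one
      | succ n => rw [add_two, precSeries_add_two, ih]
  · rintro rfl
    exact Prod.ext rfl ((eq_precAug_lam_iff a _).2 ⟨precSeries_one a, precSeries_add_two a⟩)

end Solution

section Primitive

variable {B : Type*} [NormedRing B] [NormedAlgebra ℝ B]

/-- The series `∑_{n ≥ 1} (∫_0^s x_n(u) du) λ ^ n` in `λ B[[λ]]`, for `x` in `λ 𝒜[[λ]]`. -/
noncomputable def primitiveAt (s : ℝ) (x : FormalSeries ℝ (LocInt B)) : B⟦X⟧ :=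
  .mk fun n => (R (x.1 n)).1 s

theorem coeff_primitiveAt (s : ℝ) (x : FormalSeries ℝ (LocInt B)) (n : ℕ) :
    coeff n (primitiveAt s x) = (R (x.1 n)).1 s :=
  coeff_mk _ _

theorem constantCoeff_primitiveAt (s : ℝ) (x : FormalSeries ℝ (LocInt B)) :
    constantCoeff (primitiveAt s x) = 0 := by
  have coeff_zero : x.1 0 = 0 := x.2
  rw [← coeff_zero_eq_constantCoeff_apply, coeff_primitiveAt, coeff_zero, map_zero]
  rfl

variable [CompleteSpace B]

theorem primitiveAt_starMul (s : ℝ) (x y : FormalSeries ℝ (LocInt B)) :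
    primitiveAt s (starMul ℝ x y) = primitiveAt s x * primitiveAt s y := by
  ext n
  have coeff_starMul : (starMul ℝ x y).1 n = ∑ ij ∈ Finset.HasAntidiagonal.antidiagonal n,
      (locPrec (x.1 ij.1) (y.1 ij.2) + locSucc (x.1 ij.1) (y.1 ij.2)) :=
    Finset.sum_add_distrib.symm
  simp only [coeff_mul, coeff_primitiveAt, coeff_starMul, map_sum, R_mul_R]
  simp

theorem primitiveAt_starPow (s : ℝ) (x : FormalSeries ℝ (LocInt B)) (m : ℕ) :
    primitiveAt s (starPow ℝ x m) = primitiveAt s x ^ (m + 1) := by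
  induction m with
  | zero => rw [zero_add, pow_one, starPow]
  | succ m ih => rw [starPow, primitiveAt_starMul, ih, ← pow_succ']

theorem map_R_logStar (X : ℝ × FormalSeries ℝ (LocInt B)) (s : ℝ) (n : ℕ) :
    ((FormalSeries.map R (FormalSeries.logStar X)).1 n).1 s =
      ∫ y in (0 : ℝ)..1, coeff n (geomSeries (-y) (primitiveAt s X.2)) := by
  have integral_neg_pow (m : ℕ) :
      ∫ y in (0 : ℝ)..1, (-y) ^ m = -((-1) ^ (m + 1) / ((m + 1 : ℕ) : ℝ)) := by
    rw [intervalIntegral.integral_comp_neg fun y => y ^ m, integral_pow]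
    simp [neg_div]
  simp only [coeff_geomSeries]
  rw [intervalIntegral.integral_finsetSum fun m _ =>
    Continuous.intervalIntegrable (by fun_prop) _ _]
  simp only [intervalIntegral.integral_smul_const, integral_neg_pow, ← primitiveAt_starPow,
    coeff_primitiveAt]
  simp [FormalSeries.map, FormalSeries.logStar]

end Primitive

section Dyson

variable {B : Type*} [NormedRing B] [NormedAlgebra ℝ B] [CompleteSpace B]

/-- The Dyson series `1 + λ ∫_0^t a + λ ^ 2 ∫_0^t a(u) ∫_0^u a + ⋯`. -/
noncomputable def dyson (a : LocInt B) (t : ℝ) : B⟦X⟧ := 1 + primitiveAt t (precSeries ℝ a)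

theorem coeff_zero_dyson (a : LocInt B) (t : ℝ) : coeff 0 (dyson a t) = 1 := by
  simp [dyson, constantCoeff_primitiveAt]

theorem coeff_succ_dyson_eq_R (a : LocInt B) (t : ℝ) (n : ℕ) :
    coeff (n + 1) (dyson a t) = (R ((precSeries ℝ a).1 (n + 1))).1 t := by
  simp [dyson, coeff_primitiveAt, coeff_one]

theorem continuous_coeff_dyson (a : LocInt B) (n : ℕ) :
    Continuous fun t => coeff n (dyson a t) := by
  cases n with
  | zero => simpa only [coeff_zero_dyson] using continuous_const
  | succ n => simpa only [coeff_succ_dyson_eq_R] using R_continuous _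

theorem coeff_succ_dyson (a : LocInt B) (t : ℝ) (n : ℕ) :
    coeff (n + 1) (dyson a t) = ∫ v in (0 : ℝ)..t, a.1 v * coeff n (dyson a v) := by
  rw [coeff_succ_dyson_eq_R]
  cases n with
  | zero => simp [coeff_zero_dyson, precSeries_one, R_apply]
  | succ n =>
    simp only [precSeries_add_two, coeff_succ_dyson_eq_R]
    rfl

theorem continuous_coeff_dyson_mul (a : LocInt B) (W : B⟦X⟧) (n : ℕ) :
    Continuous fun t => coeff n (dyson a t * W) := by
  simp only [coeff_mul]
  exact continuous_finsetSum _ fun ij _ => (continuous_coeff_dyson a ij.1).mul continuous_const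

theorem coeff_succ_dyson_mul (a : LocInt B) (W : B⟦X⟧) (t : ℝ) (n : ℕ) :
    coeff (n + 1) (dyson a t * W) =
      coeff (n + 1) W + ∫ v in (0 : ℝ)..t, a.1 v * coeff n (dyson a v * W) := by
  have integrable (i : ℕ) : IntervalIntegrable (fun v => a.1 v * coeff i (dyson a v)) volume 0 t :=
    loc_int (locInt_mul_continuous a (continuous_coeff_dyson a i)) _ _
  simp only [coeff_mul, Finset.mul_sum, ← mul_assoc]
  rw [Finset.Nat.sum_antidiagonal_succ, coeff_zero_dyson, one_mul,
    intervalIntegral.integral_finsetSum fun ij _ => (integrable ij.1).mul_const _]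
  congr 1
  refine Finset.sum_congr rfl fun ij _ => ?_
  rw [coeff_succ_dyson]
  exact ((ContinuousLinearMap.mul ℝ B).flip (coeff ij.2 W)).intervalIntegral_comp_comm
    (integrable ij.1) |>.symm

end Dyson

section WeightedDyson

theorem integral_stepWeight_smul {E : Type*} [NormedAddCommGroup E] [NormedSpace ℝ E] {f : ℝ → E}
    (hf : LocallyIntegrable f volume) (x : ℝ) {s t : ℝ} (ht : t ∈ Set.Icc 0 s) :
    ∫ v in Set.Ioo 0 s, stepWeight x t v • f v =
      (∫ v in (0 : ℝ)..t, f v) + x • ∫ v in (0 : ℝ)..s, f v := by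
  have integrable : IntegrableOn f (Set.Ioo 0 s) volume := integrableOn_Ioo hf 0 s
  have integrable_smul : IntegrableOn (fun v => x • f v) (Set.Ioo 0 s) volume :=
    integrable.smul x
  have inter_eq : Set.Ioo 0 s ∩ Set.Iio t = Set.Ioo 0 t := by
    rw [Set.Ioo_inter_Iio, min_eq_right ht.2]
  have stepWeight_smul (v : ℝ) :
      stepWeight x t v • f v = (Set.Iio t).indicator f v + x • f v := by
    by_cases h : v < t <;> simp [stepWeight, h, add_smul]
  rw [intervalIntegral.integral_of_le ht.1, intervalIntegral.integral_of_le (ht.1.trans ht.2),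
    integral_Ioc_eq_integral_Ioo, integral_Ioc_eq_integral_Ioo, ← inter_eq,
    ← setIntegral_indicator measurableSet_Iio, ← integral_smul,
    ← integral_add (integrable.indicator measurableSet_Iio) integrable_smul]
  exact integral_congr_ae (.of_forall stepWeight_smul)

variable {B : Type*} [NormedRing B] [NormedAlgebra ℝ B] [CompleteSpace B]

/-- The series `U(t) (1 - x (U(s) - 1))⁻¹`, where `U` is the Dyson series of `a`. Its
coefficients are the iterates on `1` of the kernel operator with kernel `stepWeight x` on
`(0, s)`. -/
noncomputable def weightedDyson (a : LocInt B) (x s t : ℝ) : B⟦X⟧ :=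
  dyson a t * (1 + x • geomSeries x (primitiveAt s (precSeries ℝ a)))

theorem locallyIntegrable_mul_coeff_weightedDyson (a : LocInt B) (x s : ℝ) (n : ℕ) :
    LocallyIntegrable (fun v => a.1 v * coeff n (weightedDyson a x s v)) volume :=
  locInt_mul_continuous a (continuous_coeff_dyson_mul a _ n)

theorem coeff_succ_geomSeries_primitiveAt (a : LocInt B) (x s : ℝ) (n : ℕ) :
    coeff (n + 1) (geomSeries x (primitiveAt s (precSeries ℝ a))) =
      ∫ v in (0 : ℝ)..s, a.1 v * coeff n (weightedDyson a x s v) := by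
  refine add_left_cancel ((coeff_succ_dyson_mul a _ s n).symm.trans ?_).symm
  rw [dyson, add_mul, one_mul, ← geomSeries_eq_mul (constantCoeff_primitiveAt s _), map_add]

theorem coeff_zero_weightedDyson (a : LocInt B) (x s t : ℝ) :
    coeff 0 (weightedDyson a x s t) = 1 := by
  simp [weightedDyson, coeff_mul, coeff_zero_dyson, coeff_geomSeries]

theorem coeff_succ_weightedDyson (a : LocInt B) (x s t : ℝ) (n : ℕ) :
    coeff (n + 1) (weightedDyson a x s t) =
      (∫ v in (0 : ℝ)..t, a.1 v * coeff n (weightedDyson a x s v)) +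
        x • ∫ v in (0 : ℝ)..s, a.1 v * coeff n (weightedDyson a x s v) := by
  rw [← coeff_succ_geomSeries_primitiveAt, weightedDyson, coeff_succ_dyson_mul, add_comm]
  simp [weightedDyson, coeff_one]

theorem coeff_weightedDyson_eq_pathIntegral (a : LocInt B) (x : ℝ) {s t : ℝ}
    (ht : t ∈ Set.Icc 0 s) (n : ℕ) :
    coeff n (weightedDyson a x s t) =
      pathIntegral (volume.restrict (Set.Ioo 0 s)) (stepWeight x) a.1 n t := by
  induction n generalizing t with
  | zero => rw [coeff_zero_weightedDyson, pathIntegral_zero]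
  | succ n ih =>
    rw [coeff_succ_weightedDyson, pathIntegral_succ (measurable_stepWeight x) (norm_stepWeight_le x)
      (integrableOn_Ioo a.2 0 s), ← integral_stepWeight_smul
      (locallyIntegrable_mul_coeff_weightedDyson a x s n) x ht]
    refine setIntegral_congr_fun measurableSet_Ioo fun v hv => ?_
    simp only [ih (Set.Ioo_subset_Icc_self hv)]

theorem coeff_succ_geomSeries_eq_sum_perm (a : LocInt B) (x : ℝ) {s : ℝ} (hs : 0 ≤ s) (n : ℕ) :
    coeff (n + 1) (geomSeries x (primitiveAt s (precSeries ℝ a))) =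
      ∑ σ : Equiv.Perm (Fin (n + 1)), (x ^ descents σ * (1 + x) ^ (n - descents σ)) •
        ∫ u in simplex (n + 1) s, orderedProd a.1 σ u := by
  have integrable := integrableOn_Ioo a.2 0 s
  calc
    _ = ∫ v in Set.Ioo 0 s, a.1 v * coeff n (weightedDyson a x s v) := by
      rw [coeff_succ_geomSeries_primitiveAt, intervalIntegral.integral_of_le hs,
        integral_Ioc_eq_integral_Ioo]
    _ = ∫ v in Set.Ioo 0 s, a.1 v *
          pathIntegral (volume.restrict (Set.Ioo 0 s)) (stepWeight x) a.1 n v :=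
      setIntegral_congr_fun measurableSet_Ioo fun v hv => by
        simp only [coeff_weightedDyson_eq_pathIntegral a x (Set.Ioo_subset_Icc_self hv)]
    _ = ∫ u : Fin (n + 1) → ℝ, pathWeight (stepWeight x) u • pathProd a.1 u
          ∂(Measure.pi fun _ => volume.restrict (Set.Ioo 0 s)) :=
      (integral_pathWeight_smul_pathProd (measurable_stepWeight x) (norm_stepWeight_le x)
        integrable n).symm
    _ = _ := by
      rw [integral_pathWeight_stepWeight_eq_sum_perm integrable, restrict_simplex]
      rfl

theorem integral_neg_pow_mul_one_sub_pow_descents {n : ℕ} (σ : Equiv.Perm (Fin (n + 1))) :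
    ∫ y in (0 : ℝ)..1, (-y) ^ descents σ * (1 + -y) ^ (n - descents σ) =
      (-1) ^ descents σ / ((n + 1 : ℕ) * n.choose (descents σ)) := by
  have factor_sign (y : ℝ) : (-y) ^ descents σ * (1 + -y) ^ (n - descents σ) =
      (-1) ^ descents σ * (y ^ descents σ * (1 - y) ^ (n - descents σ)) := by
    rw [neg_pow, mul_assoc, ← sub_eq_add_neg]
  simp only [factor_sign]
  rw [intervalIntegral.integral_const_mul, integral_pow_mul_one_sub_pow,
    Nat.add_sub_cancel' (descents_le σ), mul_one_div]

end WeightedDyson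

end Magnus

theorem corollary5p5 {B : Type*} [NormedRing B] [NormedAlgebra ℝ B] [CompleteSpace B]
    (a : Magnus.LocInt B) :
    -- the linear dendriform equation `X = 𝟏 + λ a ≺ X` has exactly one solution
    (∃! X : ℝ × Magnus.FormalSeries ℝ (Magnus.LocInt B),
      Magnus.IsSolution ℝ (Magnus.FormalSeries.lam ℝ a) X) ∧
    -- and `Ω(λ a) = R(Ω'(λ a))`, with `Ω'(λ a) = log^* X`, is given by the stated series
    ∀ X : ℝ × Magnus.FormalSeries ℝ (Magnus.LocInt B),
      Magnus.IsSolution ℝ (Magnus.FormalSeries.lam ℝ a) X →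
      ∀ s : ℝ, 0 < s → ∀ n : ℕ, 0 < n →
        (∀ σ : Equiv.Perm (Fin n),
          MeasureTheory.IntegrableOn (Magnus.orderedProd a.1 σ) (Magnus.simplex n s)
            MeasureTheory.volume) ∧
        ((Magnus.FormalSeries.map Magnus.R (Magnus.FormalSeries.logStar X)).1 n).1 s =
          ∑ σ : Equiv.Perm (Fin n),
            ((-1 : ℝ) ^ Magnus.descents σ /
                ((n : ℝ) * ((n - 1).choose (Magnus.descents σ) : ℝ))) •
              ∫ u in Magnus.simplex n s, Magnus.orderedProd a.1 σ u := by
  refine ⟨⟨_, (Magnus.isSolution_lam_iff a _).2 rfl, fun X => (Magnus.isSolution_lam_iff a X).1⟩,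
    ?_⟩
  intro X hX s hs n hn
  refine ⟨Magnus.integrableOn_orderedProd a.2 s, ?_⟩
  obtain rfl := (Magnus.isSolution_lam_iff a X).1 hX
  obtain ⟨n, rfl⟩ := Nat.exists_eq_succ_of_ne_zero hn.ne'
  simp only [Magnus.map_R_logStar, Magnus.coeff_succ_geomSeries_eq_sum_perm a _ hs.le]
  rw [intervalIntegral.integral_finsetSum fun σ _ =>
    Continuous.intervalIntegrable (by fun_prop) _ _]
  refine Finset.sum_congr rfl fun σ _ => ?_
  rw [intervalIntegral.integral_smul_const, Magnus.integral_neg_pow_mul_one_sub_pow_descents]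
  rfl
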